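/- Theorem 3.7. Let $(\mathcal C,\mathbb E,\mathfrak s)$ be an extriangulated category (in the sense of Nakaoka and Palu) with enough projectives and enough injectives, and write $\mathcal P$ and $\mathcal I$ for its subcategories of projective and of injective objects. Let $\mathcal X$ be a cluster tilting subcategory of $\mathcal C$: $\mathcal X$ is functorially finite, $M\in\mathcal X$ if and only if $\mathbb E(M,\mathcal X)=0$, and $M\in\mathcal X$ if and only if $\mathbb E(\mathcal X,M)=0$. Let $\mathcal A=\mathcal C/\mathcal X$ be the category with the objects of $\mathcal C$ whose morphisms are the morphisms of $\mathcal C$ modulo those that factor through an object of $\mathcal X$. For a class $\mathcal Y$ of objects, let $\Omega\mathcal Y$ be the class of all objects $W$ admitting an $\mathbb E$-triangle $W\to P\to Y\dashrightarrow$ with $P\in\mathcal P$ and $Y\in\mathcal Y$ (then $W$ is called a syzygy of $Y$), and let $\Sigma\mathcal Y$ be the class of all objects $W$ admitting an $\mathbb E$-triangle $Y\to I\to W\dashrightarrow$ with $I\in\mathcal I$ and $Y\in\mathcal Y$ (then $W$ is called a cosyzygy of $Y$). Let $\Omega\mathcal X/\mathcal X$ and $\Sigma\mathcal X/\mathcal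 X$ be the full subcategories of $\mathcal A$ of all objects isomorphic in $\mathcal A$ to an object of $\Omega\mathcal X$, respectively of $\Sigma\mathcal X$. Then $\mathcal A$, with the addition of morphisms induced from $\mathcal C$, is an abelian category, and the following hold. (1) $\mathcal A$ has enough projectives and enough injectives. The projective objects of $\mathcal A$ are exactly the direct summands (that is, retracts) in $\mathcal A$ of objects of $\Omega\mathcal X/\mathcal X$, and the injective objects of $\mathcal A$ are exactly the direct summands in $\mathcal A$ of objects of $\Sigma\mathcal X/\mathcal X$. If $\Omega\mathcal X/\mathcal X$ is idempotent complete, then the projective objects of $\mathcal A$ are exactly the objects of $\Omega\mathcal X/\mathcal X$; if $\Sigma\mathcal X/\mathcal X$ is idempotent complete, then the injective objects of $\mathcal A$ are exactly the objects of $\Sigma\mathcal X/\mathcal X$. (2) If $\Sigma(\Omega\mathcal X)\subseteq\mathcal X$ and $\Omega(\Sigma\mathcal X)\subseteq\mathcal X$, then $\mathcal A$ is Gorenstein (all projective objects have finite injective dimension and all injective objects have finite projective dimension) of Gorenstein dimension at most one: the supremum of the injective dimensions of the projective objects and of the projective dimensions of the injective objects of $\mathcal A$ is at most $1$. The same conclusion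 holds if it is only assumed that each $X\in\mathcal X$ has some syzygy $W$ that has some cosyzygy lying in $\mathcal X$, and that each $X\in\mathcal X$ has some cosyzygy $W'$ that has some syzygy lying in $\mathcal X$. -/

import Mathlib

open CategoryTheory CategoryTheory.Limits

universe w v u

/-- An extriangulated structure (in the sense of Nakaoka and Palu) on an additive category:
a biadditive functor `E` and an additive realization of `E`, satisfying (ET3), (ET4)
and their duals. `IsTriangle x y δ` says that `A ⟶ B ⟶ C` with maps `x`, `y` belongs to the
equivalence class realizing `δ ∈ E(C, A)`, i.e. that `A ⟶ B ⟶ C ⇢ δ` is an `E`-triangle. -/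
structure Extriangulation (C : Type u) [Category.{v} C] [Preadditive C] [HasZeroObject C]
    [HasBinaryBiproducts C] where
  /-- the bifunctor `Cᵒᵖ × C ⥤ Ab`, in curried form -/
  E : Cᵒᵖ ⥤ C ⥤ AddCommGrpCat.{w}
  additive_right : ∀ Z : Cᵒᵖ, (E.obj Z).Additive
  additive_left : ∀ A : C, (E.flip.obj A).Additive
  IsTriangle : ∀ {A B Z : C}, (A ⟶ B) → (B ⟶ Z) → ((E.obj (Opposite.op Z)).obj A) → Prop
  /-- every extension is realized -/
  exists_triangle : ∀ {A Z : C} (δ : (E.obj (Opposite.op Z)).obj A),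
    ∃ (B : C) (x : A ⟶ B) (y : B ⟶ Z), IsTriangle x y δ
  /-- the sequences realizing a given extension form exactly one equivalence class -/
  isTriangle_iff : ∀ {A B B' Z : C} (x : A ⟶ B) (y : B ⟶ Z) (x' : A ⟶ B') (y' : B' ⟶ Z)
    (δ : (E.obj (Opposite.op Z)).obj A), IsTriangle x y δ →
      (IsTriangle x' y' δ ↔ ∃ b : B ≅ B', x ≫ b.hom = x' ∧ b.hom ≫ y' = y)
  /-- morphisms of extensions are realized -/
  realize : ∀ {A B Z A' B' Z' : C} (x : A ⟶ B) (y : B ⟶ Z)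
    (δ : (E.obj (Opposite.op Z)).obj A) (x' : A' ⟶ B') (y' : B' ⟶ Z')
    (δ' : (E.obj (Opposite.op Z')).obj A') (a : A ⟶ A') (c : Z ⟶ Z'),
    IsTriangle x y δ → IsTriangle x' y' δ' →
    (E.obj (Opposite.op Z)).map a δ = (E.map c.op).app A' δ' →
    ∃ b : B ⟶ B', x ≫ b = a ≫ x' ∧ y ≫ c = b ≫ y'
  /-- the zero extension is realized by the split sequence -/
  zero_triangle : ∀ A Z : C, IsTriangle (biprod.inl : A ⟶ A ⊞ Z) (biprod.snd : A ⊞ Z ⟶ Z) 0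
  /-- the direct sum of two extensions is realized by the direct sum of the realizations;
  the extension `δ ⊕ δ'` is the sum of the images of `δ` and `δ'` in `E(Z ⊞ Z', A ⊞ A')` -/
  sum_triangle : ∀ {A B Z A' B' Z' : C} (x : A ⟶ B) (y : B ⟶ Z)
    (δ : (E.obj (Opposite.op Z)).obj A) (x' : A' ⟶ B') (y' : B' ⟶ Z')
    (δ' : (E.obj (Opposite.op Z')).obj A'),
    IsTriangle x y δ → IsTriangle x' y' δ' →
    IsTriangle (biprod.map x x') (biprod.map y y')
      ((E.map (biprod.fst : Z ⊞ Z' ⟶ Z).op).app (A ⊞ A')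
          ((E.obj (Opposite.op Z)).map (biprod.inl : A ⟶ A ⊞ A') δ) +
        (E.map (biprod.snd : Z ⊞ Z' ⟶ Z').op).app (A ⊞ A')
          ((E.obj (Opposite.op Z')).map (biprod.inr : A' ⟶ A ⊞ A') δ'))
  et3 : ∀ {A B Z A' B' Z' : C} (x : A ⟶ B) (y : B ⟶ Z)
    (δ : (E.obj (Opposite.op Z)).obj A) (x' : A' ⟶ B') (y' : B' ⟶ Z')
    (δ' : (E.obj (Opposite.op Z')).obj A') (a : A ⟶ A') (b : B ⟶ B'),
    IsTriangle x y δ → IsTriangle x' y' δ' → x ≫ b = a ≫ x' →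
    ∃ c : Z ⟶ Z', y ≫ c = b ≫ y' ∧
      (E.obj (Opposite.op Z)).map a δ = (E.map c.op).app A' δ'
  et3_op : ∀ {A B Z A' B' Z' : C} (x : A ⟶ B) (y : B ⟶ Z)
    (δ : (E.obj (Opposite.op Z)).obj A) (x' : A' ⟶ B') (y' : B' ⟶ Z')
    (δ' : (E.obj (Opposite.op Z')).obj A') (b : B ⟶ B') (c : Z ⟶ Z'),
    IsTriangle x y δ → IsTriangle x' y' δ' → y ≫ c = b ≫ y' →
    ∃ a : A ⟶ A', x ≫ b = a ≫ x' ∧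
      (E.obj (Opposite.op Z)).map a δ = (E.map c.op).app A' δ'
  et4 : ∀ {A B D G F : C} (f : A ⟶ B) (f' : B ⟶ D) (δ : (E.obj (Opposite.op D)).obj A)
    (g : B ⟶ G) (g' : G ⟶ F) (δ' : (E.obj (Opposite.op F)).obj B),
    IsTriangle f f' δ → IsTriangle g g' δ' →
    ∃ (H : C) (d : D ⟶ H) (e : H ⟶ F) (h' : G ⟶ H) (δ'' : (E.obj (Opposite.op H)).obj A),
      g ≫ h' = f' ≫ d ∧ h' ≫ e = g' ∧ IsTriangle (f ≫ g) h' δ'' ∧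
      IsTriangle d e ((E.obj (Opposite.op F)).map f' δ') ∧
      (E.map d.op).app A δ'' = δ ∧
      (E.obj (Opposite.op H)).map f δ'' = (E.map e.op).app B δ'
  et4_op : ∀ {D A B F G : C} (f' : D ⟶ A) (f : A ⟶ B) (δ : (E.obj (Opposite.op B)).obj D)
    (g' : F ⟶ B) (g : B ⟶ G) (δ' : (E.obj (Opposite.op G)).obj F),
    IsTriangle f' f δ → IsTriangle g' g δ' →
    ∃ (H : C) (d : D ⟶ H) (e : H ⟶ F) (h' : H ⟶ A) (δ'' : (E.obj (Opposite.op G)).obj H),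
      h' ≫ f = e ≫ g' ∧ d ≫ h' = f' ∧ IsTriangle h' (f ≫ g) δ'' ∧
      IsTriangle d e ((E.map g'.op).app D δ) ∧
      (E.obj (Opposite.op G)).map e δ'' = δ' ∧
      (E.obj (Opposite.op B)).map d δ = (E.map g.op).app H δ''

namespace Extriangulation

variable {C : Type u} [Category.{v} C] [Preadditive C] [HasZeroObject C] [HasBinaryBiproducts C]
  (T : Extriangulation.{w} C)

/-- The group `E(Z, A)` of extensions. -/
abbrev Ext (Z A : C) : Type w := (T.E.obj (Opposite.op Z)).obj A

/-- The projective objects of an extriangulated category. -/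
def IsProj : ObjectProperty C := fun P =>
  ∀ ⦃A B Z : C⦄ (x : A ⟶ B) (y : B ⟶ Z) (δ : T.Ext Z A), T.IsTriangle x y δ →
    ∀ c : P ⟶ Z, ∃ b : P ⟶ B, b ≫ y = c

/-- The injective objects of an extriangulated category. -/
def IsInj : ObjectProperty C := fun I =>
  ∀ ⦃A B Z : C⦄ (x : A ⟶ B) (y : B ⟶ Z) (δ : T.Ext Z A), T.IsTriangle x y δ →
    ∀ a : A ⟶ I, ∃ b : B ⟶ I, x ≫ b = a

/-- `W` is a syzygy of `Z`: there is an `E`-triangle `W ⟶ P ⟶ Z ⇢` with `P` projective. -/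
def IsSyzygyOf (W Z : C) : Prop :=
  ∃ (P : C) (x : W ⟶ P) (y : P ⟶ Z) (δ : T.Ext Z W), T.IsProj P ∧ T.IsTriangle x y δ

/-- `W` is a cosyzygy of `A`: there is an `E`-triangle `A ⟶ I ⟶ W ⇢` with `I` injective. -/
def IsCosyzygyOf (W A : C) : Prop :=
  ∃ (I : C) (x : A ⟶ I) (y : I ⟶ W) (δ : T.Ext W A), T.IsInj I ∧ T.IsTriangle x y δ

def HasEnoughProj : Prop := ∀ Z : C, ∃ W : C, T.IsSyzygyOf W Z

def HasEnoughInj : Prop := ∀ A : C, ∃ W : C, T.IsCosyzygyOf W A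

/-- `Ω X`, the subcategory of all syzygies of objects of `X`. -/
def syzygy (X : ObjectProperty C) : ObjectProperty C := fun W => ∃ Z, X Z ∧ T.IsSyzygyOf W Z

/-- `Σ X`, the subcategory of all cosyzygies of objects of `X`. -/
def cosyzygy (X : ObjectProperty C) : ObjectProperty C := fun W => ∃ A, X A ∧ T.IsCosyzygyOf W A

/-- Cluster tilting subcategories. The first two fields say that `X` is functorially finite:
each object has a left and a right `X`-approximation. -/
structure IsClusterTilting (X : ObjectProperty C) : Prop where
  left_approx : ∀ M : C, ∃ (X₀ : C) (f : M ⟶ X₀), X X₀ ∧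
    ∀ (X' : C) (g : M ⟶ X'), X X' → ∃ h : X₀ ⟶ X', f ≫ h = g
  right_approx : ∀ M : C, ∃ (X₀ : C) (f : X₀ ⟶ M), X X₀ ∧
    ∀ (X' : C) (g : X' ⟶ M), X X' → ∃ h : X' ⟶ X₀, h ≫ f = g
  mem_iff_left : ∀ M : C, X M ↔ ∀ X' : C, X X' → ∀ δ : T.Ext M X', δ = 0
  mem_iff_right : ∀ M : C, X M ↔ ∀ X' : C, X X' → ∀ δ : T.Ext X' M, δ = 0

end Extriangulation

section AdditiveQuotient

variable {C : Type u} [Category.{v} C] [Preadditive C]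

/-- The morphism `f` factors through an object of `X`. -/
def FactorsThroughObj (X : ObjectProperty C) {A B : C} (f : A ⟶ B) : Prop :=
  ∃ (Z : C) (a : A ⟶ Z) (b : Z ⟶ B), X Z ∧ a ≫ b = f

/-- The subgroup of `Hom(A, B)` generated by the morphisms that factor through an object of `X`.
If `X` contains a zero object and is closed under binary direct sums, these morphisms
already form a subgroup, see `mem_factorSubgroup_iff`. -/
def factorSubgroup (X : ObjectProperty C) (A B : C) : AddSubgroup (A ⟶ B) :=
  AddSubgroup.closure {f | FactorsThroughObj X f}

/-- Two morphisms are identified in `C/X` if their difference factors through `X`. -/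
def factorRel (X : ObjectProperty C) : HomRel C :=
  fun A B f g => f - g ∈ factorSubgroup X A B

theorem comp_mem_factorSubgroup (X : ObjectProperty C) {A B Z : C} (f : A ⟶ B) {g : B ⟶ Z}
    (hg : g ∈ factorSubgroup X B Z) : f ≫ g ∈ factorSubgroup X A Z := by
  induction hg using AddSubgroup.closure_induction with
  | mem g hg =>
    obtain ⟨W, a, b, hW, rfl⟩ := hg
    exact AddSubgroup.subset_closure ⟨W, f ≫ a, b, hW, by simp⟩
  | zero => simp
  | add g g' _ _ h h' => simpa using AddSubgroup.add_mem _ h h'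
  | neg g _ h => simpa using AddSubgroup.neg_mem _ h

theorem mem_factorSubgroup_comp (X : ObjectProperty C) {A B Z : C} {f : A ⟶ B} (g : B ⟶ Z)
    (hf : f ∈ factorSubgroup X A B) : f ≫ g ∈ factorSubgroup X A Z := by
  induction hf using AddSubgroup.closure_induction with
  | mem f hf =>
    obtain ⟨W, a, b, hW, rfl⟩ := hf
    exact AddSubgroup.subset_closure ⟨W, a, b ≫ g, hW, by simp⟩
  | zero => simp
  | add g g' _ _ h h' => simpa using AddSubgroup.add_mem _ h h'
  | neg g _ h => simpa using AddSubgroup.neg_mem _ h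

theorem mem_factorSubgroup_iff [HasBinaryBiproducts C] (X : ObjectProperty C)
    (hzero : ∃ Z, X Z ∧ IsZero Z) (hsum : ∀ Z Z', X Z → X Z' → X (Z ⊞ Z'))
    {A B : C} (f : A ⟶ B) : f ∈ factorSubgroup X A B ↔ FactorsThroughObj X f := by
  refine ⟨fun hf => ?_, fun hf => AddSubgroup.subset_closure hf⟩
  induction hf using AddSubgroup.closure_induction with
  | mem f hf => exact hf
  | zero =>
    obtain ⟨Z, hZ, _⟩ := hzero
    exact ⟨Z, 0, 0, hZ, by simp⟩
  | add f f' _ _ h h' =>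
    obtain ⟨Z, a, b, hZ, rfl⟩ := h
    obtain ⟨Z', a', b', hZ', rfl⟩ := h'
    exact ⟨Z ⊞ Z', biprod.lift a a', biprod.desc b b', hsum _ _ hZ hZ', by simp⟩
  | neg f _ h =>
    obtain ⟨Z, a, b, hZ, rfl⟩ := h
    exact ⟨Z, a, -b, hZ, by simp⟩

instance factorRel_congruence (X : ObjectProperty C) : Congruence (factorRel X) where
  equivalence :=
    { refl := fun f => by simp [factorRel]
      symm := fun {f g} h => by simpa [factorRel] using AddSubgroup.neg_mem _ h
      trans := fun {f g k} h h' => by simpa [factorRel] using AddSubgroup.add_mem _ h h' }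
  comp_left f _ _ h := by
    simpa [factorRel, Preadditive.comp_sub] using comp_mem_factorSubgroup X f h
  comp_right g h := by
    simpa [factorRel, Preadditive.sub_comp] using mem_factorSubgroup_comp X g h

/-- The quotient category `C/X`: its objects are those of `C`, and its morphisms are those of `C`
modulo the morphisms that factor through an object of `X`. -/
abbrev AdditiveQuotient (X : ObjectProperty C) : Type u := CategoryTheory.Quotient (factorRel X)

/-- The group structure on the morphisms of `C/X` induced by the one of `C`. -/
instance additiveQuotientPreadditive (X : ObjectProperty C) : Preadditive (AdditiveQuotient X) :=
  CategoryTheory.Quotient.preadditive (factorRel X) (fun A B f f' g g' hf hg => by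
    have h := AddSubgroup.add_mem _ hf hg
    rwa [← add_sub_add_comm] at h)

/-- For a subcategory `Y` of `C`, the full subcategory of `C/X` of all objects isomorphic in `C/X`
to an object of `Y`. -/
abbrev imageInQuotient (X Y : ObjectProperty C) : ObjectProperty (AdditiveQuotient X) :=
  Y.map (CategoryTheory.Quotient.functor (factorRel X))

end AdditiveQuotient

section Gorenstein

variable (A : Type u) [Category.{v} A] [Abelian A]

/-- An abelian category with enough projectives and enough injectives is Gorenstein if its
projective objects have finite injective dimension and its injective objects have finite
projective dimension. -/
structure IsGorensteinCategory : Prop where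
  enoughProjectives : EnoughProjectives A
  enoughInjectives : EnoughInjectives A
  injectiveDimension_ne_top : ∀ P : A, Projective P → injectiveDimension P ≠ ⊤
  projectiveDimension_ne_top : ∀ I : A, Injective I → projectiveDimension I ≠ ⊤

/-- The Gorenstein dimension: the supremum of the injective dimensions of the projective objects
and the projective dimensions of the injective objects. The dimension of a zero object
is `⊥`. -/
noncomputable def gorensteinDimension : WithBot ℕ∞ :=
  (⨆ (P : A) (_ : Projective P), injectiveDimension P) ⊔
    (⨆ (I : A) (_ : Injective I), projectiveDimension I)

end Gorenstein

/-! The half-exact sequences relating Hom and `E` along an `E`-triangle turn factorization questions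
into the vanishing of extensions (`push_eq_zero_iff`, `pull_eq_zero_iff`).

Adding an object of X to the target does not change a morphism of C/X. Given a triangle M ⟶ X₀ ⟶ X₁
with X₀, X₁ in X and first map i, a morphism f : M ⟶ N is therefore represented by the inflation (i,
f) : M ⟶ X₀ ⊞ N, along which every morphism from M to X extends. For such an inflation the cone is a
cokernel in C/X (`epi_map`, `nonempty_isColimit`); dually, deflations give kernels. If an inflation
becomes mono in C/X, then morphisms from X to its cone lift along the deflation
(`exists_coextension_of_mono`), so the same triangle exhibits the inflation as a kernel. Hence
monomorphisms, and dually epimorphisms, are normal, and C/X is abelian.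

For a syzygy W ⟶ P ⟶ Z with Z in X, the obstruction to lifting a morphism from W through an
epimorphism extends to P, where it vanishes; so W is projective in C/X. Each M is a quotient of any
syzygy of the X₁ above, so the projectives are the retracts of such syzygies. The injective case is
dual.

For the Gorenstein property, let W have a cosyzygy in X. From X₁ ⟶ X₀ ⟶ W and an inflation of X₀
into an injective, the octahedron yields W ⟶ J ⟶ J' with J and J' cosyzygies of X₁ and X₀. This
becomes an injective resolution of length one in C/X, and every projective is a retract of such a W.
-/

namespace Extriangulation

/-! ### Exact sequences and octahedra for `E`-triangles -/

section Extensions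

variable {C : Type u} [Category.{v} C] [Preadditive C] [HasZeroObject C] [HasBinaryBiproducts C]
  (T : Extriangulation.{w} C)

/-- The image of an extension under a morphism of the first terms. -/
def push {Z A A' : C} (a : A ⟶ A') (δ : T.Ext Z A) : T.Ext Z A' :=
  (T.E.obj (Opposite.op Z)).map a δ

/-- The image of an extension under a morphism into the last term. -/
def pull {Z' Z A : C} (c : Z' ⟶ Z) (δ : T.Ext Z A) : T.Ext Z' A :=
  (T.E.map c.op).app A δ

@[simp]
theorem push_id {Z A : C} (δ : T.Ext Z A) : T.push (𝟙 A) δ = δ := by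
  simp [push]

@[simp]
theorem pull_id {Z A : C} (δ : T.Ext Z A) : T.pull (𝟙 Z) δ = δ := by
  simp [pull]

theorem push_comp {Z A A' A'' : C} (a : A ⟶ A') (a' : A' ⟶ A'') (δ : T.Ext Z A) :
    T.push (a ≫ a') δ = T.push a' (T.push a δ) := by
  simp [push]

theorem pull_comp {Z Z' Z'' A : C} (c : Z'' ⟶ Z') (c' : Z' ⟶ Z) (δ : T.Ext Z A) :
    T.pull (c ≫ c') δ = T.pull c (T.pull c' δ) := by
  simp [pull]

theorem push_pull {Z Z' A A' : C} (a : A ⟶ A') (c : Z' ⟶ Z) (δ : T.Ext Z A) :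
    T.push a (T.pull c δ) = T.pull c (T.push a δ) := by
  simp [push, pull]

@[simp]
theorem push_zero {Z A A' : C} (a : A ⟶ A') : T.push a (0 : T.Ext Z A) = 0 := by
  simp [push]

@[simp]
theorem pull_zero {Z Z' A : C} (c : Z' ⟶ Z) : T.pull c (0 : T.Ext Z A) = 0 := by
  simp [pull]

theorem add_pull {Z Z' A : C} (c c' : Z' ⟶ Z) (δ : T.Ext Z A) :
    T.pull (c + c') δ = T.pull c δ + T.pull c' δ := by
  have := T.additive_left A
  have h : (T.E.flip.obj A).map (c.op + c'.op) = _ := Functor.map_add _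
  exact ConcreteCategory.congr_hom h δ

theorem ext_eq_zero_of_isZero_left {Z A : C} (hZ : IsZero Z) (δ : T.Ext Z A) : δ = 0 := by
  have h := T.add_pull (𝟙 Z) (𝟙 Z) δ
  rw [hZ.eq_of_src (𝟙 Z + 𝟙 Z) (𝟙 Z)] at h
  simpa using h

/-- Comparison with these degenerate split triangles, by (ET3) or its dual, yields the exactness
statements below. -/
theorem isTriangle_id_left (A : C) {Z : C} (hZ : IsZero Z) :
    T.IsTriangle (𝟙 A) (0 : A ⟶ Z) 0 :=
  (T.isTriangle_iff _ _ _ _ _ (T.zero_triangle A Z)).2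
    ⟨{ hom := biprod.fst
       inv := biprod.inl
       hom_inv_id := by
        rw [← biprod.total]
        simp [hZ.eq_of_tgt (biprod.snd : A ⊞ Z ⟶ Z) 0] }, by simp, hZ.eq_of_tgt _ _⟩

theorem isTriangle_id_right (Z : C) {A : C} (hA : IsZero A) :
    T.IsTriangle (0 : A ⟶ Z) (𝟙 Z) 0 :=
  (T.isTriangle_iff _ _ _ _ _ (T.zero_triangle A Z)).2
    ⟨{ hom := biprod.snd
       inv := biprod.inr
       hom_inv_id := by
        rw [← biprod.total]
        simp [hA.eq_of_tgt (biprod.fst : A ⊞ Z ⟶ A) 0] }, hA.eq_of_src _ _, by simp⟩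

namespace IsTriangle

variable {T} {A B Z : C} {x : A ⟶ B} {y : B ⟶ Z} {δ : T.Ext Z A}

theorem comp_eq_zero (h : T.IsTriangle x y δ) : x ≫ y = 0 := by
  obtain ⟨O, hO⟩ := HasZeroObject.zero (C := C)
  obtain ⟨c, hc, -⟩ := T.et3 _ _ _ x y δ (𝟙 A) x (T.isTriangle_id_left A hO) h rfl
  simpa using hc.symm

theorem exists_desc (h : T.IsTriangle x y δ) {D : C} (g : B ⟶ D) (hg : x ≫ g = 0) :
    ∃ c : Z ⟶ D, y ≫ c = g := by
  obtain ⟨O, hO⟩ := HasZeroObject.zero (C := C)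
  obtain ⟨c, hc, -⟩ := T.et3 x y δ _ _ _ (0 : A ⟶ O) g h (T.isTriangle_id_right D hO) (by simpa)
  exact ⟨c, by simpa using hc⟩

theorem exists_lift (h : T.IsTriangle x y δ) {D : C} (g : D ⟶ B) (hg : g ≫ y = 0) :
    ∃ a : D ⟶ A, a ≫ x = g := by
  obtain ⟨O, hO⟩ := HasZeroObject.zero (C := C)
  obtain ⟨a, ha, -⟩ := T.et3_op _ _ _ x y δ g (0 : O ⟶ Z) (T.isTriangle_id_left D hO) h
    (by simpa using hg.symm)
  exact ⟨a, by simpa using ha.symm⟩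

/-- Both directions come from a morphism of triangles to A' = A' ⟶ 0: its middle component is an
extension of `a` along `x`. -/
theorem push_eq_zero_iff (h : T.IsTriangle x y δ) {A' : C} (a : A ⟶ A') :
    T.push a δ = 0 ↔ ∃ b : B ⟶ A', x ≫ b = a := by
  obtain ⟨O, hO⟩ := HasZeroObject.zero (C := C)
  have h' := T.isTriangle_id_left A' hO
  constructor
  · intro ha
    obtain ⟨b, hb, -⟩ := T.realize x y δ _ _ _ a (0 : Z ⟶ O) h h' (by
      change T.push a δ = T.pull 0 0
      rw [ha, pull_zero])
    exact ⟨b, by simpa using hb⟩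
  · rintro ⟨b, hb⟩
    obtain ⟨c, -, hc⟩ := T.et3 x y δ _ _ _ a b h h' (by simpa using hb)
    exact hc.trans (T.pull_zero c)

theorem pull_eq_zero_iff (h : T.IsTriangle x y δ) {Z' : C} (c : Z' ⟶ Z) :
    T.pull c δ = 0 ↔ ∃ b : Z' ⟶ B, b ≫ y = c := by
  obtain ⟨O, hO⟩ := HasZeroObject.zero (C := C)
  have h' := T.isTriangle_id_right Z' hO
  constructor
  · intro hc
    obtain ⟨b, -, hb⟩ := T.realize _ _ _ x y δ (0 : O ⟶ A) c h' h (by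
      change T.push 0 0 = T.pull c δ
      rw [hc, push_zero])
    exact ⟨b, by simpa using hb.symm⟩
  · rintro ⟨b, hb⟩
    obtain ⟨a, -, ha⟩ := T.et3_op _ _ _ x y δ b c h' h (by simpa using hb.symm)
    exact ha.symm.trans (T.push_zero a)

@[simp]
theorem push_self (h : T.IsTriangle x y δ) : T.push x δ = 0 :=
  (h.push_eq_zero_iff x).2 ⟨𝟙 B, by simp⟩

@[simp]
theorem pull_self (h : T.IsTriangle x y δ) : T.pull y δ = 0 :=
  (h.pull_eq_zero_iff y).2 ⟨𝟙 B, by simp⟩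

/-- When `ε` dies on B, `y` lifts to the middle term of a realization of `ε`; the dual of (ET3),
with identity on Z, supplies `a`. -/
theorem exists_push_eq (h : T.IsTriangle x y δ) {D : C} (ε : T.Ext Z D) (hε : T.pull y ε = 0) :
    ∃ a : A ⟶ D, T.push a δ = ε := by
  obtain ⟨G, i, p, hG⟩ := T.exists_triangle ε
  obtain ⟨b, hb⟩ := (hG.pull_eq_zero_iff y).1 hε
  obtain ⟨a, -, ha⟩ := T.et3_op x y δ i p ε b (𝟙 Z) h hG (by simp [hb])
  exact ⟨a, ha.trans (T.pull_id ε)⟩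

theorem exists_pull_eq (h : T.IsTriangle x y δ) {D : C} (ε : T.Ext D A) (hε : T.push x ε = 0) :
    ∃ c : D ⟶ Z, T.pull c δ = ε := by
  obtain ⟨G, i, p, hG⟩ := T.exists_triangle ε
  obtain ⟨b, hb⟩ := (hG.push_eq_zero_iff x).1 hε
  obtain ⟨c, -, hc⟩ := T.et3 i p ε x y δ (𝟙 A) b hG h (by simp [hb])
  exact ⟨c, hc.symm.trans (T.push_id ε)⟩

theorem exists_push_eq_pull (h : T.IsTriangle x y δ) {A' B' Z' : C} {x' : A' ⟶ B'} {y' : B' ⟶ Z'}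
    {δ' : T.Ext Z' A'} (h' : T.IsTriangle x' y' δ') (b : B ⟶ B') (c : Z ⟶ Z')
    (hbc : y ≫ c = b ≫ y') : ∃ a : A ⟶ A', x ≫ b = a ≫ x' ∧ T.push a δ = T.pull c δ' :=
  T.et3_op x y δ x' y' δ' b c h h' hbc

theorem exists_pull_eq_push (h : T.IsTriangle x y δ) {A' B' Z' : C} {x' : A' ⟶ B'} {y' : B' ⟶ Z'}
    {δ' : T.Ext Z' A'} (h' : T.IsTriangle x' y' δ') (a : A ⟶ A') (b : B ⟶ B')
    (hab : x ≫ b = a ≫ x') : ∃ c : Z ⟶ Z', y ≫ c = b ≫ y' ∧ T.push a δ = T.pull c δ' :=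
  T.et3 x y δ x' y' δ' a b h h' hab

/-- If `x` is an inflation, so is `(x, f)`. -/
theorem exists_triangle_lift (h : T.IsTriangle x y δ) {D : C} (f : A ⟶ D) :
    ∃ (K : C) (y' : B ⊞ D ⟶ K) (δ' : T.Ext K A), T.IsTriangle (biprod.lift x f) y' δ' := by
  obtain ⟨O, hO⟩ := HasZeroObject.zero (C := C)
  -- (x, f) is the split inflation (1, f) followed by x ⊕ 1, and (ET4) shows that the composite is
  -- an inflation.
  have h₁ : T.IsTriangle (biprod.lift (𝟙 A) f) (biprod.desc (-f) (𝟙 D)) 0 :=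
    (T.isTriangle_iff _ _ _ _ _ (T.zero_triangle A D)).2
      ⟨{ hom := biprod.lift biprod.fst (biprod.fst ≫ f + biprod.snd)
         inv := biprod.lift biprod.fst (biprod.snd - biprod.fst ≫ f) },
        by ext <;> simp, by ext <;> simp⟩
  have h₂ := T.sum_triangle _ _ _ _ _ _ h (T.isTriangle_id_left D hO)
  obtain ⟨H, -, -, h', δ'', -, -, hH, -⟩ := T.et4 _ _ _ _ _ _ h₁ h₂
  refine ⟨H, h', δ'', ?_⟩
  convert hH using 1
  ext <;> simp

/-- If `y` is a deflation, so is `(y, f)`. -/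
theorem exists_triangle_desc (h : T.IsTriangle x y δ) {D : C} (f : D ⟶ Z) :
    ∃ (K : C) (x' : K ⟶ B ⊞ D) (δ' : T.Ext Z K), T.IsTriangle x' (biprod.desc y f) δ' := by
  obtain ⟨O, hO⟩ := HasZeroObject.zero (C := C)
  have h₁ : T.IsTriangle (biprod.lift (-f) (𝟙 D)) (biprod.desc (𝟙 Z) f) 0 :=
    (T.isTriangle_iff _ _ _ _ _ (T.zero_triangle D Z)).2
      ⟨{ hom := biprod.lift (biprod.snd - biprod.fst ≫ f) biprod.fst
         inv := biprod.lift biprod.snd (biprod.fst + biprod.snd ≫ f) },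
        by ext <;> simp, by ext <;> simp⟩
  have h₂ := T.sum_triangle _ _ _ _ _ _ h (T.isTriangle_id_right D hO)
  obtain ⟨H, -, -, h', δ'', -, -, hH, -⟩ := T.et4_op _ _ _ _ _ _ h₂ h₁
  refine ⟨H, h', δ'', ?_⟩
  convert hH using 1
  ext <;> simp

/-- The octahedral axiom for the composition of two inflations. -/
theorem exists_octahedron (h : T.IsTriangle x y δ) {G F : C} {g : B ⟶ G} {g' : G ⟶ F}
    {δ' : T.Ext F B} (h' : T.IsTriangle g g' δ') :
    ∃ (H : C) (d : Z ⟶ H) (e : H ⟶ F) (k : G ⟶ H) (δ'' : T.Ext H A),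
      g ≫ k = y ≫ d ∧ k ≫ e = g' ∧ T.IsTriangle (x ≫ g) k δ'' ∧
      T.IsTriangle d e (T.push y δ') ∧ T.pull d δ'' = δ ∧ T.push x δ'' = T.pull e δ' :=
  T.et4 x y δ g g' δ' h h'

/-- The octahedral axiom for the composition of two deflations. -/
theorem exists_octahedron_op (h : T.IsTriangle x y δ) {G F : C} {g' : F ⟶ Z} {g : Z ⟶ G}
    {δ' : T.Ext G F} (h' : T.IsTriangle g' g δ') :
    ∃ (H : C) (d : A ⟶ H) (e : H ⟶ F) (k : H ⟶ B) (δ'' : T.Ext G H),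
      k ≫ y = e ≫ g' ∧ d ≫ k = x ∧ T.IsTriangle k (y ≫ g) δ'' ∧
      T.IsTriangle d e (T.pull g' δ) ∧ T.push e δ'' = δ' ∧ T.push d δ = T.pull g δ'' :=
  T.et4_op x y δ g' g δ' h h'

end IsTriangle

variable {T} in
theorem IsProj.ext_eq_zero {P A : C} (hP : T.IsProj P) (δ : T.Ext P A) : δ = 0 := by
  obtain ⟨B, x, y, h⟩ := T.exists_triangle δ
  rw [← T.pull_id δ, h.pull_eq_zero_iff]
  exact hP x y δ h _

variable {T} in
theorem IsInj.ext_eq_zero {I Z : C} (hI : T.IsInj I) (δ : T.Ext Z I) : δ = 0 := by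
  obtain ⟨B, x, y, h⟩ := T.exists_triangle δ
  rw [← T.push_id δ, h.push_eq_zero_iff]
  exact hI x y δ h _

end Extensions

/-! ### Approximations by a cluster tilting subcategory -/

namespace IsClusterTilting

variable {C : Type u} [Category.{v} C] [Preadditive C] [HasZeroObject C] [HasBinaryBiproducts C]
  {T : Extriangulation.{w} C} {X : ObjectProperty C}

theorem ext_eq_zero (hX : T.IsClusterTilting X) {A Z : C} (hZ : X Z) (hA : X A)
    (δ : T.Ext Z A) : δ = 0 :=
  (hX.mem_iff_left Z).1 hZ A hA δ

theorem mem_of_isProj (hX : T.IsClusterTilting X) {P : C} (hP : T.IsProj P) : X P :=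
  (hX.mem_iff_left P).2 fun _ _ δ => hP.ext_eq_zero δ

theorem mem_of_isInj (hX : T.IsClusterTilting X) {I : C} (hI : T.IsInj I) : X I :=
  (hX.mem_iff_right I).2 fun _ _ δ => hI.ext_eq_zero δ

theorem mem_of_isZero (hX : T.IsClusterTilting X) {Z : C} (hZ : IsZero Z) : X Z :=
  (hX.mem_iff_left Z).2 fun _ _ δ => T.ext_eq_zero_of_isZero_left hZ δ

theorem mem_biprod (hX : T.IsClusterTilting X) (Z Z' : C) (hZ : X Z) (hZ' : X Z') :
    X (Z ⊞ Z') :=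
  (hX.mem_iff_left _).2 fun W hW δ => by
    rw [← T.pull_id δ, ← biprod.total, add_pull, pull_comp, pull_comp,
      hX.ext_eq_zero hZ hW (T.pull biprod.inl δ), hX.ext_eq_zero hZ' hW (T.pull biprod.inr δ),
      pull_zero, pull_zero, add_zero]

/-- A morphism is zero in the quotient category iff it factors through `X`. -/
theorem functor_map_eq_zero_iff (hX : T.IsClusterTilting X) {A B : C} (f : A ⟶ B) :
    (Quotient.functor (factorRel X)).map f = 0 ↔ FactorsThroughObj X f := by
  obtain ⟨O, hO⟩ := HasZeroObject.zero (C := C)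
  rw [← mem_factorSubgroup_iff X ⟨O, hX.mem_of_isZero hO, hO⟩ hX.mem_biprod]
  have h : (Quotient.functor (factorRel X)).map (0 : A ⟶ B) = 0 := rfl
  rw [← h, Quotient.functor_map_eq_iff, factorRel, sub_zero]

/-- A morphism from `A` to an object of `X` extends along an inflation whose cone is in `X`. -/
theorem exists_extension (hX : T.IsClusterTilting X) {A B Z : C} {x : A ⟶ B} {y : B ⟶ Z}
    {δ : T.Ext Z A} (h : T.IsTriangle x y δ) (hZ : X Z) {X' : C} (hX' : X X') (a : A ⟶ X') :
    ∃ b : B ⟶ X', x ≫ b = a :=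
  (h.push_eq_zero_iff a).1 (hX.ext_eq_zero hZ hX' _)

/-- A morphism from an object of `X` lifts along a deflation whose cocone is in `X`. -/
theorem exists_coextension (hX : T.IsClusterTilting X) {A B Z : C} {x : A ⟶ B} {y : B ⟶ Z}
    {δ : T.Ext Z A} (h : T.IsTriangle x y δ) (hA : X A) {X' : C} (hX' : X X') (c : X' ⟶ Z) :
    ∃ b : X' ⟶ B, b ≫ y = c :=
  (h.pull_eq_zero_iff c).1 (hX.ext_eq_zero hX' hA _)

/-- The cone of an inflation into an object of `X` that is a left `X`-approximation. -/
theorem cone_mem (hX : T.IsClusterTilting X) {A B Z : C} {x : A ⟶ B} {y : B ⟶ Z}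
    {δ : T.Ext Z A} (h : T.IsTriangle x y δ) (hB : X B)
    (hx : ∀ ⦃X' : C⦄, X X' → ∀ a : A ⟶ X', ∃ b : B ⟶ X', x ≫ b = a) : X Z :=
  (hX.mem_iff_left Z).2 fun W hW ε => by
    -- Since E(B, W) = 0, each extension of Z by W is pushed out from `δ` along some `a`, which
    -- extends along `x`.
    obtain ⟨a, rfl⟩ := h.exists_push_eq ε (hX.ext_eq_zero hB hW _)
    exact (h.push_eq_zero_iff a).2 (hx hW a)

/-- The cocone of a deflation from an object of `X` that is a right `X`-approximation. -/
theorem cocone_mem (hX : T.IsClusterTilting X) {A B Z : C} {x : A ⟶ B} {y : B ⟶ Z}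
    {δ : T.Ext Z A} (h : T.IsTriangle x y δ) (hB : X B)
    (hy : ∀ ⦃X' : C⦄, X X' → ∀ c : X' ⟶ Z, ∃ b : X' ⟶ B, b ≫ y = c) : X A :=
  (hX.mem_iff_right A).2 fun W hW ε => by
    obtain ⟨c, rfl⟩ := h.exists_pull_eq ε (hX.ext_eq_zero hW hB _)
    exact (h.pull_eq_zero_iff c).2 (hy hW c)

/-- A left approximation need not be an inflation, but it becomes one after adding an inflation into
an injective. Injectives lie in X, so the sum is still an approximation and `cone_mem` applies. -/
theorem exists_left_triangle (hX : T.IsClusterTilting X) (hinj : T.HasEnoughInj) (M : C) :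
    ∃ (X₀ X₁ : C) (x : M ⟶ X₀) (y : X₀ ⟶ X₁) (δ : T.Ext X₁ M),
      X X₀ ∧ X X₁ ∧ T.IsTriangle x y δ := by
  obtain ⟨W, I, i, p, ε, hI, hε⟩ := hinj M
  obtain ⟨X₀, f, hX₀, hf⟩ := hX.left_approx M
  obtain ⟨K, y, δ, h⟩ := hε.exists_triangle_lift f
  have hmem := hX.mem_biprod _ _ (hX.mem_of_isInj hI) hX₀
  refine ⟨_, K, _, y, δ, hmem, hX.cone_mem h hmem fun X' hX' a => ?_, h⟩
  obtain ⟨b, hb⟩ := hf X' a hX'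
  exact ⟨biprod.snd ≫ b, by simp [hb]⟩

theorem exists_right_triangle (hX : T.IsClusterTilting X) (hproj : T.HasEnoughProj) (M : C) :
    ∃ (X₁ X₀ : C) (x : X₁ ⟶ X₀) (y : X₀ ⟶ M) (δ : T.Ext M X₁),
      X X₁ ∧ X X₀ ∧ T.IsTriangle x y δ := by
  obtain ⟨W, P, i, p, ε, hP, hε⟩ := hproj M
  obtain ⟨X₀, f, hX₀, hf⟩ := hX.right_approx M
  obtain ⟨K, x, δ, h⟩ := hε.exists_triangle_desc f
  have hmem := hX.mem_biprod _ _ (hX.mem_of_isProj hP) hX₀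
  refine ⟨K, _, x, _, δ, hX.cocone_mem h hmem fun X' hX' c => ?_, hmem, h⟩
  obtain ⟨b, hb⟩ := hf X' c hX'
  exact ⟨b ≫ biprod.inr, by simp [hb]⟩

end IsClusterTilting

end Extriangulation
-- Additive structure of the quotient
section Quotient

variable {C : Type u} [Category.{v} C] [Preadditive C]

/-- The quotient functor `C ⥤ C/X`. -/
abbrev toQuotient (X : ObjectProperty C) : C ⥤ AdditiveQuotient X :=
  CategoryTheory.Quotient.functor (factorRel X)

instance toQuotient_additive (X : ObjectProperty C) : (toQuotient X).Additive where
  map_add := rfl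

theorem exists_toQuotient_map_eq {X : ObjectProperty C} {M N : AdditiveQuotient X} (f : M ⟶ N) :
    ∃ g : M.as ⟶ N.as, (toQuotient X).map g = f :=
  (toQuotient X).map_surjective (X := M.as) (Y := N.as) f

instance hasZeroObject_additiveQuotient [HasZeroObject C] (X : ObjectProperty C) :
    HasZeroObject (AdditiveQuotient X) := by
  obtain ⟨O, hO⟩ := HasZeroObject.zero (C := C)
  exact ⟨_, (toQuotient X).map_isZero hO⟩

instance hasBinaryBiproducts_additiveQuotient [HasBinaryBiproducts C] (X : ObjectProperty C) :
    HasBinaryBiproducts (AdditiveQuotient X) where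
  has_binary_biproduct M N := by
    have := preservesBinaryBiproducts_of_preservesBiproducts (toQuotient X)
    exact (toQuotient X).hasBinaryBiproduct_of_preserves M.as N.as

end Quotient

/-! ### Retracts in idempotent complete subcategories -/

section Idempotents

variable {D : Type u} [Category.{v} D] (P : ObjectProperty D) [P.IsClosedUnderIsomorphisms]

theorem retractClosure_eq_self_of_isIdempotentComplete
    (h : IsIdempotentComplete P.FullSubcategory) : P.retractClosure = P := by
  refine le_antisymm ?_ P.le_retractClosure
  rintro M ⟨Y, hY, ⟨r⟩⟩
  obtain ⟨Z, i, e, hie, hei⟩ := h.idempotents_split ⟨Y, hY⟩ (P.homMk (r.r ≫ r.i))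
    (by ext; simp)
  have hie' : i.hom ≫ e.hom = 𝟙 _ := congr_arg (fun f => f.hom) hie
  have hei' : e.hom ≫ i.hom = r.r ≫ r.i := congr_arg (fun f => f.hom) hei
  refine P.prop_of_iso (⟨i.hom ≫ r.r, r.i ≫ e.hom, ?_, ?_⟩ : Z.obj ≅ M) Z.property
  · rw [Category.assoc, ← reassoc_of% hei', reassoc_of% hie', hie']
  · rw [Category.assoc, reassoc_of% hei']
    simp

end Idempotents

/-! ### Homological dimensions in an abelian category -/

section AbelianDimension

variable {A : Type u} [Category.{v} A] [Abelian A]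

theorem injectiveDimension_le_one_of_isColimit {W J J' : A} {d : W ⟶ J} {e : J ⟶ J'}
    (w : d ≫ e = 0) [Mono d] [Injective J] [Injective J']
    (h : IsColimit (CokernelCofork.ofπ e w)) : injectiveDimension W ≤ 1 := by
  have hS : (ShortComplex.mk d e w).ShortExact :=
    { exact := ShortComplex.exact_of_g_is_cokernel _ h
      mono_f := ‹_›
      epi_g := Cofork.IsColimit.epi h }
  -- Dimension at most 1 means `HasInjectiveDimensionLT W 2`, and `HasInjectiveDimensionLT J' 1` is
  -- injectivity of J'.
  exact (injectiveDimension_le_iff W 1).2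
    (hS.hasInjectiveDimensionLT_X₁ 1 (inferInstanceAs (HasInjectiveDimensionLT J' 1))
      (inferInstanceAs (HasInjectiveDimensionLT J (1 + 1))))

theorem projectiveDimension_le_one_of_isLimit {W Q Q' : A} {d : Q' ⟶ Q} {e : Q ⟶ W}
    (w : d ≫ e = 0) [Epi e] [Projective Q] [Projective Q']
    (h : IsLimit (KernelFork.ofι d w)) : projectiveDimension W ≤ 1 := by
  have hS : (ShortComplex.mk d e w).ShortExact :=
    { exact := ShortComplex.exact_of_f_is_kernel _ h
      mono_f := Fork.IsLimit.mono h
      epi_g := ‹_› }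
  exact (projectiveDimension_le_iff W 1).2
    (hS.hasProjectiveDimensionLT_X₃ 1 (inferInstanceAs (HasProjectiveDimensionLT Q' 1))
      (inferInstanceAs (HasProjectiveDimensionLT Q (1 + 1))))

variable (A) in
-- A projective is a retract of any object mapping onto it, and dimensions do not increase under
-- retracts; dually for injectives.
theorem isGorensteinCategory_and_gorensteinDimension_le_one
    [EnoughProjectives A] [EnoughInjectives A]
    (hp : ∀ M : A, ∃ (W : A) (g : W ⟶ M), Epi g ∧ injectiveDimension W ≤ 1)
    (hi : ∀ M : A, ∃ (W : A) (g : M ⟶ W), Mono g ∧ projectiveDimension W ≤ 1) :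
    IsGorensteinCategory A ∧ gorensteinDimension A ≤ 1 := by
  have hp' (P : A) (_ : Projective P) : injectiveDimension P ≤ 1 := by
    obtain ⟨W, g, _, hW⟩ := hp P
    have r : Retract P W := ⟨Projective.factorThru (𝟙 P) g, g, by simp⟩
    exact r.injectiveDimension_le.trans hW
  have hi' (I : A) (_ : Injective I) : projectiveDimension I ≤ 1 := by
    obtain ⟨W, g, _, hW⟩ := hi I
    have r : Retract I W := ⟨g, Injective.factorThru (𝟙 I) g, by simp⟩
    exact r.projectiveDimension_le.trans hW
  have h1 : (1 : WithBot ℕ∞) < ⊤ := by decide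
  exact ⟨⟨inferInstance, inferInstance, fun P hP => ((hp' P hP).trans_lt h1).ne,
    fun I hI => ((hi' I hI).trans_lt h1).ne⟩, sup_le (iSup₂_le hp') (iSup₂_le hi')⟩

end AbelianDimension
-- Kernels, cokernels and abelianness of the quotient
namespace Extriangulation.IsClusterTilting

variable {C : Type u} [Category.{v} C] [Preadditive C] [HasZeroObject C] [HasBinaryBiproducts C]
  {T : Extriangulation.{w} C} {X : ObjectProperty C}

theorem map_eq_zero (hX : T.IsClusterTilting X) {A B Z : C} (hZ : X Z) (a : A ⟶ Z) (b : Z ⟶ B) :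
    (toQuotient X).map a ≫ (toQuotient X).map b = 0 := by
  rw [← Functor.map_comp]
  exact (hX.functor_map_eq_zero_iff _).2 ⟨Z, a, b, hZ, rfl⟩

/-- Projecting away a direct summand that lies in `X` is an isomorphism in `C/X`. -/
noncomputable def sndIso (hX : T.IsClusterTilting X) {Z : C} (hZ : X Z) (B : C) :
    (toQuotient X).obj (Z ⊞ B) ≅ (toQuotient X).obj B where
  hom := (toQuotient X).map biprod.snd
  inv := (toQuotient X).map biprod.inr
  hom_inv_id := by
    have h := hX.map_eq_zero hZ (biprod.fst : Z ⊞ B ⟶ Z) (biprod.inl : Z ⟶ Z ⊞ B)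
    rw [← Functor.map_comp] at h ⊢
    rw [← CategoryTheory.Functor.map_id, ← biprod.total, Functor.map_add, h, zero_add]
  inv_hom_id := by rw [← Functor.map_comp, biprod.inr_snd, CategoryTheory.Functor.map_id]

/-- Each morphism of `C/X` is up to isomorphism the image of an inflation that is a left
`X`-approximation up to direct summands of its target. -/
theorem exists_inflation (hX : T.IsClusterTilting X) (hinj : T.HasEnoughInj)
    {M N : AdditiveQuotient X} (f : M ⟶ N) :
    ∃ (B K : C) (x : M.as ⟶ B) (y : B ⟶ K) (δ : T.Ext K M.as) (e : (toQuotient X).obj B ≅ N),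
      T.IsTriangle x y δ ∧
      (∀ ⦃X' : C⦄, X X' → ∀ a : M.as ⟶ X', ∃ b : B ⟶ X', x ≫ b = a) ∧
      (toQuotient X).map x ≫ e.hom = f := by
  obtain ⟨f, rfl⟩ := exists_toQuotient_map_eq f
  obtain ⟨X₀, X₁, i, p, ε, hX₀, hX₁, hε⟩ := hX.exists_left_triangle hinj M.as
  obtain ⟨K, y, δ, h⟩ := hε.exists_triangle_lift f
  refine ⟨_, K, _, y, δ, hX.sndIso hX₀ N.as, h, fun X' hX' a => ?_, ?_⟩
  · obtain ⟨b, hb⟩ := hX.exists_extension hε hX₁ hX' a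
    exact ⟨biprod.fst ≫ b, by simp [hb]⟩
  · exact ((toQuotient X).map_comp _ _).symm.trans (by rw [biprod.lift_snd])

/-- Each morphism of `C/X` is up to isomorphism the image of a deflation that is a right
`X`-approximation up to direct summands of its source. -/
theorem exists_deflation (hX : T.IsClusterTilting X) (hproj : T.HasEnoughProj)
    {M N : AdditiveQuotient X} (f : M ⟶ N) :
    ∃ (K B : C) (x : K ⟶ B) (y : B ⟶ N.as) (δ : T.Ext N.as K) (e : M ≅ (toQuotient X).obj B),
      T.IsTriangle x y δ ∧
      (∀ ⦃X' : C⦄, X X' → ∀ c : X' ⟶ N.as, ∃ b : X' ⟶ B, b ≫ y = c) ∧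
      e.hom ≫ (toQuotient X).map y = f := by
  obtain ⟨f, rfl⟩ := exists_toQuotient_map_eq f
  obtain ⟨X₁, X₀, i, p, ε, hX₁, hX₀, hε⟩ := hX.exists_right_triangle hproj N.as
  obtain ⟨K, x, δ, h⟩ := hε.exists_triangle_desc f
  refine ⟨K, _, x, _, δ, (hX.sndIso hX₀ M.as).symm, h, fun X' hX' c => ?_, ?_⟩
  · obtain ⟨b, hb⟩ := hX.exists_coextension hε hX₁ hX' c
    exact ⟨b ≫ biprod.inl, by simp [hb]⟩
  · exact ((toQuotient X).map_comp _ _).symm.trans (by rw [biprod.inr_desc])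

section Triangle

variable {A B Z : C} {x : A ⟶ B} {y : B ⟶ Z} {δ : T.Ext Z A}

theorem map_comp_map_eq_zero (h : T.IsTriangle x y δ) :
    (toQuotient X).map x ≫ (toQuotient X).map y = 0 := by
  rw [← Functor.map_comp, h.comp_eq_zero, Functor.map_zero]

/-- Composing `x` with an inflation B ⟶ X₀ gives a left approximation of A, so its cone H lies in X.
A morphism from Z killed by `y` in C/X factors through Z ⟶ H. -/
theorem epi_map (hX : T.IsClusterTilting X) (hinj : T.HasEnoughInj) (h : T.IsTriangle x y δ)
    (hx : ∀ ⦃X' : C⦄, X X' → ∀ a : A ⟶ X', ∃ b : B ⟶ X', x ≫ b = a) :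
    Epi ((toQuotient X).map y) := by
  refine Preadditive.epi_of_cancel_zero _ fun {D} g hg => ?_
  obtain ⟨u, rfl⟩ := exists_toQuotient_map_eq g
  obtain ⟨W, b, c, hW, hbc⟩ := (hX.functor_map_eq_zero_iff (y ≫ u)).1
    (((toQuotient X).map_comp y u).trans hg)
  obtain ⟨X₀, X₁, i, p, ε, hX₀, hX₁, hε⟩ := hX.exists_left_triangle hinj B
  obtain ⟨H, d, e, k, δ', -, -, hH, hd, -⟩ := h.exists_octahedron hε
  have hXH : X H := hX.cone_mem hH hX₀ fun X' hX' a => by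
    obtain ⟨a', rfl⟩ := hx hX' a
    obtain ⟨b', rfl⟩ := hX.exists_extension hε hX₁ hX' a'
    exact ⟨b', by simp⟩
  obtain ⟨b', rfl⟩ := hX.exists_extension hε hX₁ hW b
  -- The obstruction to extending `u` to H is `ε` pushed along `y ≫ u`; this composite factors
  -- through `i`, which kills `ε`.
  obtain ⟨v, rfl⟩ := (hd.push_eq_zero_iff u).1 (by
    rw [← push_comp, ← hbc, Category.assoc, push_comp, hε.push_self, push_zero])
  exact (hX.functor_map_eq_zero_iff _).2 ⟨H, d, v, hXH, rfl⟩

theorem mono_map (hX : T.IsClusterTilting X) (hproj : T.HasEnoughProj) (h : T.IsTriangle x y δ)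
    (hy : ∀ ⦃X' : C⦄, X X' → ∀ c : X' ⟶ Z, ∃ b : X' ⟶ B, b ≫ y = c) :
    Mono ((toQuotient X).map x) := by
  refine Preadditive.mono_of_cancel_zero _ fun {D} g hg => ?_
  obtain ⟨u, rfl⟩ := exists_toQuotient_map_eq g
  obtain ⟨W, c, b, hW, hbc⟩ := (hX.functor_map_eq_zero_iff (u ≫ x)).1
    (((toQuotient X).map_comp u x).trans hg)
  obtain ⟨X₁, X₀, i, p, ε, hX₁, hX₀, hε⟩ := hX.exists_right_triangle hproj B
  obtain ⟨H, d, e, k, δ', -, -, hH, hd, -⟩ := hε.exists_octahedron_op h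
  have hXH : X H := hX.cocone_mem hH hX₀ fun X' hX' a => by
    obtain ⟨a', rfl⟩ := hy hX' a
    obtain ⟨b', rfl⟩ := hX.exists_coextension hε hX₁ hX' a'
    exact ⟨b', by simp⟩
  obtain ⟨b', rfl⟩ := hX.exists_coextension hε hX₁ hW b
  obtain ⟨v, rfl⟩ := (hd.pull_eq_zero_iff u).1 (by
    rw [← pull_comp, ← hbc, pull_comp, pull_comp, hε.pull_self, pull_zero, pull_zero])
  exact (hX.functor_map_eq_zero_iff _).2 ⟨H, v, e, hXH, rfl⟩

/-- An inflation that is a left `X`-approximation up to direct summands of its target has its cone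
as cokernel in `C/X`. -/
theorem nonempty_isColimit (hX : T.IsClusterTilting X) (hinj : T.HasEnoughInj)
    (h : T.IsTriangle x y δ)
    (hx : ∀ ⦃X' : C⦄, X X' → ∀ a : A ⟶ X', ∃ b : B ⟶ X', x ≫ b = a) :
    Nonempty (IsColimit (CokernelCofork.ofπ ((toQuotient X).map y)
      (map_comp_map_eq_zero (X := X) h))) := by
  have := hX.epi_map hinj h hx
  refine ⟨CokernelCofork.IsColimit.ofπ' _ _ fun {D} g hg => Classical.indefiniteDescription _ ?_⟩
  obtain ⟨g, rfl⟩ : ∃ g' : B ⟶ D.as, _ = g := exists_toQuotient_map_eq g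
  obtain ⟨W, a, b, hW, hab⟩ := (hX.functor_map_eq_zero_iff (x ≫ g)).1
    (((toQuotient X).map_comp x g).trans hg)
  obtain ⟨a', rfl⟩ := hx hW a
  -- Subtracting a morphism that factors through X makes the composite with `x` vanish already in C.
  obtain ⟨u, hu⟩ := h.exists_desc (g - a' ≫ b) (by simp [← hab])
  refine ⟨(toQuotient X).map u, ((toQuotient X).map_comp y u).symm.trans ?_⟩
  rw [hu, Functor.map_sub, Functor.map_comp, hX.map_eq_zero hW, sub_zero]

/-- A deflation that is a right `X`-approximation up to direct summands of its source has its
cocone as kernel in `C/X`. -/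
theorem nonempty_isLimit (hX : T.IsClusterTilting X) (hproj : T.HasEnoughProj)
    (h : T.IsTriangle x y δ)
    (hy : ∀ ⦃X' : C⦄, X X' → ∀ c : X' ⟶ Z, ∃ b : X' ⟶ B, b ≫ y = c) :
    Nonempty (IsLimit (KernelFork.ofι ((toQuotient X).map x)
      (map_comp_map_eq_zero (X := X) h))) := by
  have := hX.mono_map hproj h hy
  refine ⟨KernelFork.IsLimit.ofι' _ _ fun {D} g hg => Classical.indefiniteDescription _ ?_⟩
  obtain ⟨g, rfl⟩ : ∃ g' : D.as ⟶ B, _ = g := exists_toQuotient_map_eq g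
  obtain ⟨W, b, a, hW, hab⟩ := (hX.functor_map_eq_zero_iff (g ≫ y)).1
    (((toQuotient X).map_comp g y).trans hg)
  obtain ⟨a', rfl⟩ := hy hW a
  obtain ⟨u, hu⟩ := h.exists_lift (g - b ≫ a') (by simp [← hab])
  refine ⟨(toQuotient X).map u, ((toQuotient X).map_comp u x).symm.trans ?_⟩
  rw [hu, Functor.map_sub, Functor.map_comp, hX.map_eq_zero hW, sub_zero]

/-- If an inflation is a monomorphism in `C/X`, its deflation is a right `X`-approximation up to
direct summands of its source. -/
theorem exists_coextension_of_mono (hX : T.IsClusterTilting X) (hproj : T.HasEnoughProj)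
    (h : T.IsTriangle x y δ) [Mono ((toQuotient X).map x)] {X' : C} (hX' : X X') (c : X' ⟶ Z) :
    ∃ b : X' ⟶ B, b ≫ y = c := by
  obtain ⟨W, P, i, p, ω, hP, hω⟩ := hproj X'
  obtain ⟨b, hb⟩ := hP x y δ h (p ≫ c)
  -- The obstruction `pull c δ` becomes `push a ω`. As `a ≫ x` factors through P in X, monicity
  -- forces `a` to factor through X, where extensions of X' vanish.
  obtain ⟨a, ha, hac⟩ := hω.exists_push_eq_pull h b c hb.symm
  have h0 : (toQuotient X).map a = 0 := by
    rw [← cancel_mono ((toQuotient X).map x), zero_comp, ← Functor.map_comp, ← ha,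
      Functor.map_comp, hX.map_eq_zero (hX.mem_of_isProj hP)]
  obtain ⟨W', a₁, a₂, hW', rfl⟩ := (hX.functor_map_eq_zero_iff a).1 h0
  rw [← h.pull_eq_zero_iff, ← hac, push_comp, hX.ext_eq_zero hX' hW' (T.push a₁ ω), push_zero]

/-- If a deflation is an epimorphism in `C/X`, its inflation is a left `X`-approximation up to
direct summands of its target. -/
theorem exists_extension_of_epi (hX : T.IsClusterTilting X) (hinj : T.HasEnoughInj)
    (h : T.IsTriangle x y δ) [Epi ((toQuotient X).map y)] {X' : C} (hX' : X X') (a : A ⟶ X') :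
    ∃ b : B ⟶ X', x ≫ b = a := by
  obtain ⟨W, I, i, p, ω, hI, hω⟩ := hinj X'
  obtain ⟨b, hb⟩ := hI x y δ h (a ≫ i)
  obtain ⟨c, hc, hac⟩ := h.exists_pull_eq_push hω a b hb
  have h0 : (toQuotient X).map c = 0 := by
    rw [← cancel_epi ((toQuotient X).map y), comp_zero, ← Functor.map_comp, hc,
      Functor.map_comp, hX.map_eq_zero (hX.mem_of_isInj hI)]
  obtain ⟨W', c₁, c₂, hW', rfl⟩ := (hX.functor_map_eq_zero_iff c).1 h0
  rw [← h.push_eq_zero_iff, hac, pull_comp, hX.ext_eq_zero hW' hX' (T.pull c₂ ω), pull_zero]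

/-- A morphism of triangles that is the identity on the third terms, with third term in `X` and
target with middle term in `X`, gives an epimorphism in `C/X` on the first terms. -/
theorem epi_map_of_push (hX : T.IsClusterTilting X) (hZ : X Z) {A' B' : C}
    {x' : A' ⟶ B'} {y' : B' ⟶ Z} {g : A ⟶ A'} (h' : T.IsTriangle x' y' (T.push g δ))
    (hB' : X B') : Epi ((toQuotient X).map g) := by
  refine Preadditive.epi_of_cancel_zero _ fun {D} u hu => ?_
  obtain ⟨u, rfl⟩ := exists_toQuotient_map_eq u
  obtain ⟨W, a, b, hW, hab⟩ := (hX.functor_map_eq_zero_iff (g ≫ u)).1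
    (((toQuotient X).map_comp g u).trans hu)
  -- `push (g ≫ u) δ` passes through E(Z, W) = 0, so `u` extends to the middle term B' in X.
  obtain ⟨v, rfl⟩ := (h'.push_eq_zero_iff u).1 (by
    rw [← push_comp, ← hab, push_comp, hX.ext_eq_zero hZ hW (T.push a δ), push_zero])
  exact (hX.functor_map_eq_zero_iff _).2 ⟨B', x', v, hB', rfl⟩

/-- A morphism of triangles that is the identity on the first terms, with first term in `X` and
source with middle term in `X`, gives a monomorphism in `C/X` on the third terms. -/
theorem mono_map_of_pull (hX : T.IsClusterTilting X) (hA : X A) {Z' B' : C}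
    {x' : A ⟶ B'} {y' : B' ⟶ Z'} {g : Z' ⟶ Z} (h' : T.IsTriangle x' y' (T.pull g δ))
    (hB' : X B') : Mono ((toQuotient X).map g) := by
  refine Preadditive.mono_of_cancel_zero _ fun {D} u hu => ?_
  obtain ⟨u, rfl⟩ := exists_toQuotient_map_eq u
  obtain ⟨W, a, b, hW, hab⟩ := (hX.functor_map_eq_zero_iff (u ≫ g)).1
    (((toQuotient X).map_comp u g).trans hu)
  obtain ⟨v, rfl⟩ := (h'.pull_eq_zero_iff u).1 (by
    rw [← pull_comp, ← hab, pull_comp, hX.ext_eq_zero hW hA (T.pull b δ), pull_zero])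
  exact (hX.functor_map_eq_zero_iff _).2 ⟨B', v, y', hB', rfl⟩

end Triangle

theorem hasCokernel (hX : T.IsClusterTilting X) (hinj : T.HasEnoughInj)
    {M N : AdditiveQuotient X} (f : M ⟶ N) : HasCokernel f := by
  obtain ⟨B, K, x, y, δ, e, h, hx, rfl⟩ := hX.exists_inflation hinj f
  have : HasCokernel ((toQuotient X).map x) := ⟨⟨_, (hX.nonempty_isColimit hinj h hx).some⟩⟩
  exact hasCokernel_comp_iso ((toQuotient X).map x) e.hom

theorem hasKernel (hX : T.IsClusterTilting X) (hproj : T.HasEnoughProj)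
    {M N : AdditiveQuotient X} (f : M ⟶ N) : HasKernel f := by
  obtain ⟨K, B, x, y, δ, e, h, hy, rfl⟩ := hX.exists_deflation hproj f
  have : HasKernel ((toQuotient X).map y) := ⟨⟨_, (hX.nonempty_isLimit hproj h hy).some⟩⟩
  exact hasKernel_iso_comp e.hom ((toQuotient X).map y)

/-- The triangle built on an inflation representing `f` also satisfies the kernel criterion, since
`f` is mono; thus `f` is the kernel of the map to the cone. -/
theorem nonempty_normalMono (hX : T.IsClusterTilting X) (hproj : T.HasEnoughProj)
    (hinj : T.HasEnoughInj) {M N : AdditiveQuotient X} (f : M ⟶ N) [Mono f] :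
    Nonempty (NormalMono f) := by
  obtain ⟨B, K, x, y, δ, e, h, -, hf⟩ := hX.exists_inflation hinj f
  have hm : Mono ((toQuotient X).map x) := by
    have : Mono ((toQuotient X).map x ≫ e.hom) := hf ▸ ‹Mono f›
    exact mono_of_mono _ e.hom
  obtain ⟨hl⟩ := hX.nonempty_isLimit hproj h fun X' hX' c =>
    hX.exists_coextension_of_mono hproj h hX' c
  have hw := map_comp_map_eq_zero (X := X) h
  have w : f ≫ e.inv ≫ (toQuotient X).map y = 0 := by
    rw [← hf, Category.assoc, e.hom_inv_id_assoc, hw]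
  refine ⟨⟨_, e.inv ≫ (toQuotient X).map y, w, KernelFork.IsLimit.ofι' _ _ fun {D} k hk => ?_⟩⟩
  refine Classical.indefiniteDescription _ ?_
  obtain ⟨l, hl⟩ := KernelFork.IsLimit.lift' hl (k ≫ e.inv) (by simpa using hk)
  refine ⟨l, ?_⟩
  rw [← hf]
  exact (Category.assoc _ _ _).symm.trans ((e.comp_inv_eq.1 hl.symm).symm)

theorem nonempty_normalEpi (hX : T.IsClusterTilting X) (hproj : T.HasEnoughProj)
    (hinj : T.HasEnoughInj) {M N : AdditiveQuotient X} (f : M ⟶ N) [Epi f] :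
    Nonempty (NormalEpi f) := by
  obtain ⟨K, B, x, y, δ, e, h, -, hf⟩ := hX.exists_deflation hproj f
  have hm : Epi ((toQuotient X).map y) := by
    have : Epi (e.hom ≫ (toQuotient X).map y) := hf ▸ ‹Epi f›
    exact epi_of_epi e.hom _
  obtain ⟨hl⟩ := hX.nonempty_isColimit hinj h fun X' hX' a =>
    hX.exists_extension_of_epi hinj h hX' a
  have hw := map_comp_map_eq_zero (X := X) h
  have w : ((toQuotient X).map x ≫ e.inv) ≫ f = 0 := by
    rw [← hf, Category.assoc, e.inv_hom_id_assoc, hw]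
  refine ⟨⟨_, (toQuotient X).map x ≫ e.inv, w,
    CokernelCofork.IsColimit.ofπ' _ _ fun {D} k hk => ?_⟩⟩
  refine Classical.indefiniteDescription _ ?_
  obtain ⟨l, hl⟩ := CokernelCofork.IsColimit.desc' hl (e.inv ≫ k) (by simpa using hk)
  refine ⟨l, ?_⟩
  rw [← hf, Category.assoc]
  exact (e.eq_inv_comp.1 hl)

/-- The quotient of an extriangulated category with enough projectives and enough injectives by
a cluster tilting subcategory is abelian. -/
abbrev abelian (hX : T.IsClusterTilting X) (hproj : T.HasEnoughProj) (hinj : T.HasEnoughInj) :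
    Abelian (AdditiveQuotient X) where
  toPreadditive := additiveQuotientPreadditive X
  normalMonoOfMono f _ := hX.nonempty_normalMono hproj hinj f
  normalEpiOfEpi f _ := hX.nonempty_normalEpi hproj hinj f
  has_finite_products := hasFiniteProducts_of_has_binary_and_terminal
  has_kernels := ⟨fun f => hX.hasKernel hproj f⟩
  has_cokernels := ⟨fun f => hX.hasCokernel hinj f⟩

end Extriangulation.IsClusterTilting
-- Projectives, injectives and the Gorenstein property
namespace Extriangulation.IsClusterTilting

variable {C : Type u} [Category.{v} C] [Preadditive C] [HasZeroObject C] [HasBinaryBiproducts C]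
  {T : Extriangulation.{w} C} {X : ObjectProperty C}

theorem projective_of_isSyzygyOf (hX : T.IsClusterTilting X) (hproj : T.HasEnoughProj)
    (hinj : T.HasEnoughInj) {W Z : C} (hZ : X Z) (hW : T.IsSyzygyOf W Z) :
    Projective ((toQuotient X).obj W) where
  factors {M N} f g _ := by
    obtain ⟨P, i, p, ω, hP, hω⟩ := hW
    obtain ⟨f, rfl⟩ : ∃ f' : W ⟶ N.as, _ = f := exists_toQuotient_map_eq f
    obtain ⟨K, B, x, y, δ, e, h, -, hg⟩ := hX.exists_deflation hproj g
    have : Epi ((toQuotient X).map y) := by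
      have : Epi (e.hom ≫ (toQuotient X).map y) := hg ▸ ‹Epi g›
      exact epi_of_epi e.hom _
    obtain ⟨X₀, X₁, j, q, ζ, hX₀, hX₁, hζ⟩ := hX.exists_left_triangle hinj K
    -- As `y` is epi in C/X, `j` extends along `x`, so the obstruction to lifting `f` dies in E(W,
    -- X₀) and comes from a morphism W ⟶ X₁. That morphism extends to P because E(Z, X₁) = 0, and
    -- E(P, K) = 0. The lift thus exists in C itself.
    obtain ⟨c, hc⟩ := hζ.exists_pull_eq (T.pull f δ) (by
      rw [push_pull, (h.push_eq_zero_iff j).2 (hX.exists_extension_of_epi hinj h hX₀ j),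
        pull_zero])
    obtain ⟨t, rfl⟩ := hX.exists_extension hω hZ hX₁ c
    obtain ⟨b, hb⟩ := (h.pull_eq_zero_iff f).1 (by
      rw [← hc, pull_comp, hP.ext_eq_zero (T.pull t ζ), pull_zero])
    refine ⟨(toQuotient X).map b ≫ e.inv, ?_⟩
    rw [← hg, Category.assoc, e.inv_hom_id_assoc]
    exact ((toQuotient X).map_comp b y).symm.trans (by rw [hb])

theorem injective_of_isCosyzygyOf (hX : T.IsClusterTilting X) (hproj : T.HasEnoughProj)
    (hinj : T.HasEnoughInj) {W A : C} (hA : X A) (hW : T.IsCosyzygyOf W A) :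
    Injective ((toQuotient X).obj W) where
  factors {M N} f g _ := by
    obtain ⟨I, i, p, ω, hI, hω⟩ := hW
    obtain ⟨f, rfl⟩ : ∃ f' : M.as ⟶ W, _ = f := exists_toQuotient_map_eq f
    obtain ⟨B, K, x, y, δ, e, h, -, hg⟩ := hX.exists_inflation hinj g
    have : Mono ((toQuotient X).map x) := by
      have : Mono ((toQuotient X).map x ≫ e.hom) := hg ▸ ‹Mono g›
      exact mono_of_mono _ e.hom
    obtain ⟨X₁, X₀, j, q, ζ, hX₁, hX₀, hζ⟩ := hX.exists_right_triangle hproj K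
    obtain ⟨c, hc⟩ := hζ.exists_push_eq (T.push f δ) (by
      rw [← push_pull, (h.pull_eq_zero_iff q).2 (hX.exists_coextension_of_mono hproj h hX₀ q),
        push_zero])
    obtain ⟨t, rfl⟩ := hX.exists_coextension hω hA hX₁ c
    obtain ⟨b, hb⟩ := (h.push_eq_zero_iff f).1 (by
      rw [← hc, push_comp, hI.ext_eq_zero (T.push t ζ), push_zero])
    refine ⟨e.inv ≫ (toQuotient X).map b, ?_⟩
    rw [← hg, Category.assoc, e.hom_inv_id_assoc]
    exact ((toQuotient X).map_comp x b).symm.trans (by rw [hb])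

/-- Each object of `C/X` is a quotient of an arbitrary syzygy of some object of `X`. -/
theorem exists_epi (hX : T.IsClusterTilting X) (hinj : T.HasEnoughInj) (M : AdditiveQuotient X) :
    ∃ Z : C, X Z ∧ ∀ W : C, T.IsSyzygyOf W Z → ∃ g : (toQuotient X).obj W ⟶ M, Epi g := by
  obtain ⟨X₀, X₁, x, y, ζ, hX₀, hX₁, hζ⟩ := hX.exists_left_triangle hinj M.as
  refine ⟨X₁, hX₁, ?_⟩
  rintro W ⟨P, i, p, ω, hP, hω⟩
  obtain ⟨b, hb⟩ := hP x y ζ hζ p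
  -- Projectivity of P compares the syzygy triangle with `ζ` over the identity of X₁, so `ζ` is a
  -- pushout of `ω`.
  obtain ⟨g, -, hg⟩ := hω.exists_push_eq_pull hζ b (𝟙 X₁) (by simp [hb])
  rw [pull_id] at hg
  subst hg
  exact ⟨(toQuotient X).map g, hX.epi_map_of_push hX₁ hζ hX₀⟩

/-- Each object of `C/X` is a subobject of an arbitrary cosyzygy of some object of `X`. -/
theorem exists_mono (hX : T.IsClusterTilting X) (hproj : T.HasEnoughProj)
    (M : AdditiveQuotient X) :
    ∃ Z : C, X Z ∧ ∀ W : C, T.IsCosyzygyOf W Z → ∃ g : M ⟶ (toQuotient X).obj W, Mono g := by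
  obtain ⟨X₁, X₀, x, y, ζ, hX₁, hX₀, hζ⟩ := hX.exists_right_triangle hproj M.as
  refine ⟨X₁, hX₁, ?_⟩
  rintro W ⟨I, i, p, ω, hI, hω⟩
  obtain ⟨b, hb⟩ := hI x y ζ hζ i
  obtain ⟨g, -, hg⟩ := hζ.exists_pull_eq_push hω (𝟙 X₁) b (by simp [hb])
  rw [push_id] at hg
  subst hg
  exact ⟨(toQuotient X).map g, hX.mono_map_of_pull hX₁ hζ hX₀⟩

theorem enoughProjectives (hX : T.IsClusterTilting X) (hproj : T.HasEnoughProj)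
    (hinj : T.HasEnoughInj) : EnoughProjectives (AdditiveQuotient X) where
  presentation M := by
    obtain ⟨Z, hZ, h⟩ := hX.exists_epi hinj M
    obtain ⟨W, hW⟩ := hproj Z
    obtain ⟨g, hg⟩ := h W hW
    have := hX.projective_of_isSyzygyOf hproj hinj hZ hW
    exact ⟨{ p := _, f := g }⟩

theorem enoughInjectives (hX : T.IsClusterTilting X) (hproj : T.HasEnoughProj)
    (hinj : T.HasEnoughInj) : EnoughInjectives (AdditiveQuotient X) where
  presentation M := by
    obtain ⟨Z, hZ, h⟩ := hX.exists_mono hproj M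
    obtain ⟨W, hW⟩ := hinj Z
    obtain ⟨g, hg⟩ := h W hW
    exact ⟨⟨_, hX.injective_of_isCosyzygyOf hproj hinj hZ hW, g, hg⟩⟩

theorem projective_iff (hX : T.IsClusterTilting X) (hproj : T.HasEnoughProj)
    (hinj : T.HasEnoughInj) (M : AdditiveQuotient X) :
    Projective M ↔ (imageInQuotient X (T.syzygy X)).retractClosure M := by
  constructor
  · intro _
    obtain ⟨Z, hZ, h⟩ := hX.exists_epi hinj M
    obtain ⟨W, hW⟩ := hproj Z
    obtain ⟨g, _⟩ := h W hW
    exact ⟨_, ObjectProperty.prop_map_obj _ _ ⟨Z, hZ, hW⟩,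
      ⟨⟨Projective.factorThru (𝟙 M) g, g, by simp⟩⟩⟩
  · rintro ⟨N, ⟨W, ⟨Z, hZ, hW⟩, ⟨e⟩⟩, ⟨r⟩⟩
    have := hX.projective_of_isSyzygyOf hproj hinj hZ hW
    exact (r.trans (Retract.ofIso e.symm)).projective

theorem injective_iff (hX : T.IsClusterTilting X) (hproj : T.HasEnoughProj)
    (hinj : T.HasEnoughInj) (M : AdditiveQuotient X) :
    Injective M ↔ (imageInQuotient X (T.cosyzygy X)).retractClosure M := by
  constructor
  · intro _
    obtain ⟨Z, hZ, h⟩ := hX.exists_mono hproj M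
    obtain ⟨W, hW⟩ := hinj Z
    obtain ⟨g, _⟩ := h W hW
    exact ⟨_, ObjectProperty.prop_map_obj _ _ ⟨Z, hZ, hW⟩,
      ⟨⟨g, Injective.factorThru (𝟙 M) g, by simp⟩⟩⟩
  · rintro ⟨N, ⟨W, ⟨Z, hZ, hW⟩, ⟨e⟩⟩, ⟨r⟩⟩
    have := hX.injective_of_isCosyzygyOf hproj hinj hZ hW
    exact (r.trans (Retract.ofIso e.symm)).injective

/-- The octahedron on X₁ ⟶ X₀ ⟶ W and X₀ ⟶ I₀ ⟶ J' gives W ⟶ J ⟶ J', with J a cosyzygy of X₁. The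
cosyzygy of W in X makes this triangle satisfy the cokernel criterion. -/
theorem injectiveDimension_le_one (hX : T.IsClusterTilting X) (hproj : T.HasEnoughProj)
    (hinj : T.HasEnoughInj) {W V : C} (hV : X V) (hVW : T.IsCosyzygyOf V W) :
    letI := hX.abelian hproj hinj
    injectiveDimension ((toQuotient X).obj W) ≤ 1 := by
  let := hX.abelian hproj hinj
  obtain ⟨I, i, p, ω, hI, hω⟩ := hVW
  obtain ⟨X₁, X₀, a, b, ε, hX₁, hX₀, hε⟩ := hX.exists_right_triangle hproj W
  obtain ⟨J', I₀, s, t, η, hI₀, hη⟩ := hinj X₀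
  obtain ⟨J, d, e, k, δ, -, -, hJ, hd, hδ, -⟩ := hε.exists_octahedron hη
  subst hδ
  have := hX.mono_map_of_pull hX₁ hε hX₀
  have := hX.injective_of_isCosyzygyOf hproj hinj hX₁ ⟨I₀, _, k, δ, hI₀, hJ⟩
  have := hX.injective_of_isCosyzygyOf hproj hinj hX₀ ⟨I₀, s, t, η, hI₀, hη⟩
  obtain ⟨hc⟩ := hX.nonempty_isColimit hinj hd fun X' hX' c => by
    -- A morphism from W to X factors through I since V lies in X, and W ⟶ I extends along `d` since
    -- I is injective.
    obtain ⟨c', rfl⟩ := hX.exists_extension hω hV hX' c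
    obtain ⟨i', rfl⟩ := hI d e _ hd i
    exact ⟨i' ≫ c', by simp⟩
  exact injectiveDimension_le_one_of_isColimit _ hc

theorem projectiveDimension_le_one (hX : T.IsClusterTilting X) (hproj : T.HasEnoughProj)
    (hinj : T.HasEnoughInj) {W V : C} (hV : X V) (hVW : T.IsSyzygyOf V W) :
    letI := hX.abelian hproj hinj
    projectiveDimension ((toQuotient X).obj W) ≤ 1 := by
  let := hX.abelian hproj hinj
  obtain ⟨P, i, p, ω, hP, hω⟩ := hVW
  obtain ⟨X₀, X₁, a, b, ε, hX₀, hX₁, hε⟩ := hX.exists_left_triangle hinj W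
  obtain ⟨Q', P₀, s, t, η, hP₀, hη⟩ := hproj X₀
  obtain ⟨Q, d, e, k, δ, -, -, hQ, hd, hδ, -⟩ := hη.exists_octahedron_op hε
  subst hδ
  have := hX.epi_map_of_push hX₁ hε hX₀
  have := hX.projective_of_isSyzygyOf hproj hinj hX₁ ⟨P₀, k, _, δ, hP₀, hQ⟩
  have := hX.projective_of_isSyzygyOf hproj hinj hX₀ ⟨P₀, s, t, η, hP₀, hη⟩
  obtain ⟨hc⟩ := hX.nonempty_isLimit hproj hd fun X' hX' c => by
    obtain ⟨c', rfl⟩ := hX.exists_coextension hω hV hX' c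
    obtain ⟨p', rfl⟩ := hP d e _ hd p
    exact ⟨c' ≫ p', by simp⟩
  exact projectiveDimension_le_one_of_isLimit _ hc

/-- The quotient is Gorenstein of dimension at most one if each object of `X` has a syzygy with
a cosyzygy in `X` and a cosyzygy with a syzygy in `X`. -/
theorem isGorensteinCategory_quotient (hX : T.IsClusterTilting X) (hproj : T.HasEnoughProj)
    (hinj : T.HasEnoughInj)
    (h : ∀ Z : C, X Z → ∃ W V : C, T.IsSyzygyOf W Z ∧ T.IsCosyzygyOf V W ∧ X V)
    (h' : ∀ Z : C, X Z → ∃ W V : C, T.IsCosyzygyOf W Z ∧ T.IsSyzygyOf V W ∧ X V) :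
    letI := hX.abelian hproj hinj
    IsGorensteinCategory (AdditiveQuotient X) ∧ gorensteinDimension (AdditiveQuotient X) ≤ 1 := by
  let := hX.abelian hproj hinj
  have := hX.enoughProjectives hproj hinj
  have := hX.enoughInjectives hproj hinj
  refine isGorensteinCategory_and_gorensteinDimension_le_one _ (fun M => ?_) fun M => ?_
  · obtain ⟨Z, hZ, hM⟩ := hX.exists_epi hinj M
    obtain ⟨W, V, hW, hVW, hV⟩ := h Z hZ
    obtain ⟨g, hg⟩ := hM W hW
    exact ⟨_, g, hg, hX.injectiveDimension_le_one hproj hinj hV hVW⟩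
  · obtain ⟨Z, hZ, hM⟩ := hX.exists_mono hproj M
    obtain ⟨W, V, hW, hVW, hV⟩ := h' Z hZ
    obtain ⟨g, hg⟩ := hM W hW
    exact ⟨_, g, hg, hX.projectiveDimension_le_one hproj hinj hV hVW⟩

end Extriangulation.IsClusterTilting

theorem theorem3p7 {C : Type u} [Category.{v} C] [Preadditive C] [HasZeroObject C]
    [HasBinaryBiproducts C] (T : Extriangulation.{w} C)
    (hproj : T.HasEnoughProj) (hinj : T.HasEnoughInj)
    (X : ObjectProperty C) (hX : T.IsClusterTilting X) :
    ∃ ab : Abelian (AdditiveQuotient X),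
      ab.toPreadditive = additiveQuotientPreadditive X ∧
      -- (1)
      EnoughProjectives (AdditiveQuotient X) ∧
      EnoughInjectives (AdditiveQuotient X) ∧
      (∀ M : AdditiveQuotient X,
        Projective M ↔ (imageInQuotient X (T.syzygy X)).retractClosure M) ∧
      (∀ M : AdditiveQuotient X,
        Injective M ↔ (imageInQuotient X (T.cosyzygy X)).retractClosure M) ∧
      (IsIdempotentComplete (imageInQuotient X (T.syzygy X)).FullSubcategory →
        ∀ M : AdditiveQuotient X, Projective M ↔ imageInQuotient X (T.syzygy X) M) ∧
      (IsIdempotentComplete (imageInQuotient X (T.cosyzygy X)).FullSubcategory →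
        ∀ M : AdditiveQuotient X, Injective M ↔ imageInQuotient X (T.cosyzygy X) M) ∧
      -- (2), under the inclusions of subcategories
      (T.cosyzygy (T.syzygy X) ≤ X → T.syzygy (T.cosyzygy X) ≤ X →
        IsGorensteinCategory (AdditiveQuotient X) ∧
        gorensteinDimension (AdditiveQuotient X) ≤ 1) ∧
      -- (2), when it is only asked for one choice of syzygies and cosyzygies for each object
      ((∀ Z : C, X Z → ∃ W V : C, T.IsSyzygyOf W Z ∧ T.IsCosyzygyOf V W ∧ X V) →
        (∀ Z : C, X Z → ∃ W V : C, T.IsCosyzygyOf W Z ∧ T.IsSyzygyOf V W ∧ X V) →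
        IsGorensteinCategory (AdditiveQuotient X) ∧
        gorensteinDimension (AdditiveQuotient X) ≤ 1) := by
  refine ⟨hX.abelian hproj hinj, rfl, hX.enoughProjectives hproj hinj,
    hX.enoughInjectives hproj hinj, hX.projective_iff hproj hinj, hX.injective_iff hproj hinj,
    fun h M => ?_, fun h M => ?_, fun h h' => ?_,
    fun h h' => hX.isGorensteinCategory_quotient hproj hinj h h'⟩
  · rw [hX.projective_iff hproj hinj, retractClosure_eq_self_of_isIdempotentComplete _ h]
  · rw [hX.injective_iff hproj hinj, retractClosure_eq_self_of_isIdempotentComplete _ h]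
  · refine hX.isGorensteinCategory_quotient hproj hinj (fun Z hZ => ?_) fun Z hZ => ?_
    · obtain ⟨W, hW⟩ := hproj Z
      obtain ⟨V, hV⟩ := hinj W
      exact ⟨W, V, hW, hV, h V ⟨W, ⟨Z, hZ, hW⟩, hV⟩⟩
    · obtain ⟨W, hW⟩ := hinj Z
      obtain ⟨V, hV⟩ := hproj W
      exact ⟨W, V, hW, hV, h' V ⟨W, ⟨Z, hZ, hW⟩, hV⟩⟩
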